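/- A congestion game has a non-empty finite set $\Pi$ of players and a non-empty finite set $R$ of resources; every player $\pi$ has a non-empty set of strategies, each a subset of $R$, and a state $S=(S_\pi)_{\pi\in\Pi}$ selects one strategy of each player. The congestion $C_r(S)$ is the number of players $\pi$ with $r\in S_\pi$, and $C(S)=\max_{r\in R} C_r(S)$ is the bottleneck congestion. In a polynomial game of degree $\mathcal M$ (an integer $\mathcal M\ge 1$) player $\pi$ has cost $\sum_{r\in S_\pi} C_r(S)^{\mathcal M}$. A Nash equilibrium is a state in which no player can lower its cost by changing only its own strategy; it is of highest cost if $C(S)$ is largest among all Nash equilibria. Let $C^*(G)=\min_S C(S)$ over all states, and $PoA(G)=\sup_S C(S)/C^*(G)$ over all Nash equilibria $S$ (with $0/0=0$). For a constant $\beta>1$, the game $G$ dominates the game $\tilde G$ (equivalently, $\tilde G$ is dominated by $G$) with constant $\beta$ if $\tilde G$ has at most as many resources as $G$ and the same delay function, highest-cost Nash equilibria of $G$ and of $\tilde G$ have the same bottleneck congestion, and $C^*(G)\le C^*(\tilde G)\le \beta\, C^*(G)$. **Theorem.** Let $G$ be a polynomial game of degree $\mathcal M\ge 1$ with resource set $R$,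 let $S$ be a highest-cost Nash equilibrium of $G$, let $C^*=C^*(G)$ and $\psi=\max(2\mathcal M,3C^*)$. Then $G$ can be transformed into a polynomial game $\tilde G$ of degree $\mathcal M$ on the same resource set $R$, with a highest-cost Nash equilibrium $\tilde S$, such that: 1. $\tilde S$ arises from $S$ by splitting players: each player of $\tilde G$ is assigned to a player of $G$, and for each player $\pi$ of $G$ the sets $\tilde S_k$, over the players $k$ assigned to $\pi$, are pairwise disjoint with union $S_\pi$. In particular $C_r(\tilde S)=C_r(S)$ for every $r\in R$. 2. If $C_r(\tilde S)>\psi$, then every player $k$ of $\tilde G$ with $r\in\tilde S_k$ is of type A, that is, $|\tilde S_k|=1$. 3. $\tilde G$ is dominated by $G$ with constant $7$; in particular $C(\tilde S)=C(S)$ and $C^*\le \tilde C^*\le 7C^*$, where $\tilde C^*=C^*(\tilde G)$. 4. $PoA(G)\le 7\cdot PoA(\tilde G)$. -/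

import Mathlib

/-- A finite congestion game with player set `P` and resource set `R`. Every player has a nonempty
finite set of pure strategies, each of which is a set of resources. The delay cost of a resource is
`delay c`, where `c` is the number of players that use it. -/
structure CongestionGame (P R : Type*) where
  strategies : P → Finset (Finset R)
  strategies_nonempty : ∀ i, (strategies i).Nonempty
  delay : ℕ → ℕ

namespace CongestionGame

variable {P R P' R' : Type*}

/-- The congestion `C_r(S)`: the number of players whose strategy in `S` contains `r`. -/
def congestion [Fintype P] [DecidableEq R] (S : P → Finset R) (r : R) : ℕ :=
  (Finset.univ.filter fun i => r ∈ S i).card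

/-- The bottleneck congestion `C(S)`: the largest congestion of a resource. -/
def bottleneck [Fintype P] [Fintype R] [DecidableEq R] (S : P → Finset R) : ℕ :=
  Finset.univ.sup fun r => congestion S r

/-- `S` is a state (pure strategy profile) of `G`. -/
def IsState (G : CongestionGame P R) (S : P → Finset R) : Prop :=
  ∀ i, S i ∈ G.strategies i

/-- `G` is a polynomial game of degree `M`: the delay of a resource is the `M`-th power of its
congestion. -/
def IsPolynomial (G : CongestionGame P R) (M : ℕ) : Prop :=
  ∀ c, G.delay c = c ^ M

/-- The cost of player `i` in `S`: the sum of the delays of the resources that it uses. -/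
def playerCost [Fintype P] [DecidableEq R] (G : CongestionGame P R) (S : P → Finset R) (i : P) :
    ℕ :=
  ∑ r ∈ S i, G.delay (congestion S r)

/-- `S` is a pure Nash equilibrium of `G`. -/
def IsNash [Fintype P] [DecidableEq P] [DecidableEq R] (G : CongestionGame P R)
    (S : P → Finset R) : Prop :=
  G.IsState S ∧
    ∀ i, ∀ T ∈ G.strategies i, G.playerCost S i ≤ G.playerCost (Function.update S i T) i

/-- `S` is a Nash equilibrium with the highest social cost (bottleneck congestion) among all Nash
equilibria of `G`. -/
def IsHighestNash [Fintype P] [DecidableEq P] [Fintype R] [DecidableEq R]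
    (G : CongestionGame P R) (S : P → Finset R) : Prop :=
  G.IsNash S ∧ ∀ Z, G.IsNash Z → bottleneck Z ≤ bottleneck S

/-- `C*`: the smallest bottleneck congestion of a state of `G`. -/
noncomputable def optCongestion [Fintype P] [Fintype R] [DecidableEq R]
    (G : CongestionGame P R) : ℕ :=
  sInf {c | ∃ S, G.IsState S ∧ bottleneck S = c}

/-- The price of anarchy: the supremum of `C(S) / C*` over all Nash equilibria `S`. -/
noncomputable def priceOfAnarchy [Fintype P] [DecidableEq P] [Fintype R] [DecidableEq R]
    (G : CongestionGame P R) : ℝ :=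
  sSup {x | ∃ S, G.IsNash S ∧ x = (bottleneck S : ℝ) / (G.optCongestion : ℝ)}

/-- `G` dominates `G'` with constant `β`: `G'` has at most as many resources and the same delay
function, highest-cost Nash equilibria of the two games have the same bottleneck congestion, and
the optimal congestion of `G'` lies between that of `G` and `β` times that of `G`. -/
def Dominates [Fintype P] [DecidableEq P] [Fintype R] [DecidableEq R]
    [Fintype P'] [DecidableEq P'] [Fintype R'] [DecidableEq R'] (β : ℝ)
    (G : CongestionGame P R) (G' : CongestionGame P' R') : Prop :=
  1 < β ∧ Fintype.card R' ≤ Fintype.card R ∧ G'.delay = G.delay ∧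
    (∃ S S', G.IsHighestNash S ∧ G'.IsHighestNash S' ∧ bottleneck S' = bottleneck S) ∧
    G.optCongestion ≤ G'.optCongestion ∧ (G'.optCongestion : ℝ) ≤ β * (G.optCongestion : ℝ)

/-- The profile `S'` arises from `S` by splitting players: every player `k` of the new game is a
part of one player `origin k` of the old game, and the strategies of the parts of a player `i`
partition `S i`. -/
def IsSplitting (S : P → Finset R) (S' : P' → Finset R) (origin : P' → P) : Prop :=
  (∀ k, S' k ⊆ S (origin k)) ∧ ∀ i, ∀ r ∈ S i, ∃! k, origin k = i ∧ r ∈ S' k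

/-- Every player that uses in `S` a resource of congestion greater than `ψ` is of type A, that is,
uses exactly one resource. -/
def OnlyTypeAAbove [Fintype P] [DecidableEq R] (S : P → Finset R) (ψ : ℕ) : Prop :=
  ∀ r, ψ < congestion S r → ∀ i, r ∈ S i → (S i).card = 1

end CongestionGame

set_option linter.unusedSectionVars false

namespace CongestionGame

/-! Write c for C* and C_r for the congestion of r in S. If C(S) ≤ ψ, the game G itself serves; if
C(S) ≤ 7c, every used pair (player, resource) becomes a player without choice. Otherwise the
strategies are cut at a threshold t ≤ ψ. Each pair (i, r) with r ∈ S_i and C_r > t becomes a player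
of type A; the rest of S_i forms one or several low parts. On a high resource r, min(7c, C_r)
players are pinned, and each other player gets an alternative T of low resources with C_r^M ≤ ∑_{s ∈
T} (C_s + 1)^M, so that moving there does not pay.

There is room for these alternatives: summing the Nash inequalities of S against an optimal state Y
gives ∑ C_r^(M+1) ≤ ∑ C_r(Y) (C_r + 1)^M, so the excess of the high resources is at most c times the
total low weight. A balanced packing (`exists_packing`) then uses each low resource in at most 2c
alternatives. The low parts may use a further 5c: for M ≤ 8c they stay in place and t ≤ 5c; for M >
8c they get alternatives derived from Y, of congestion at most 4c (`exists_low_alternatives`). If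
all players take their alternatives, the congestion is thus at most 7c.

No worse equilibrium arises (`isTransform_twoStrategyGame`): a congestion above C(S) requires a type
A player on its alternative, but its own resource never exceeds C(S) in any state, so returning is
cheaper. The pinned players keep the optimum at least c. -/

/-! ### Greedy packing and colouring of weighted sets -/

theorem exists_subset_sum_between {ι : Type*} [DecidableEq ι] (w : ι → ℕ) (μ : ℕ) (X : Finset ι)
    (hμ : ∀ s ∈ X, w s ≤ μ) (b : ℕ) (hb : b ≤ ∑ s ∈ X, w s) :
    ∃ T ⊆ X, b ≤ ∑ s ∈ T, w s ∧ ∑ s ∈ T, w s ≤ b + (μ - 1) ∧ (b = 0 → T = ∅) := by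
  rcases Nat.eq_zero_or_pos b with rfl | hb0
  · exact ⟨∅, by simp, by simp, by simp, fun _ => rfl⟩
  induction X using Finset.induction_on with
  | empty => simp at hb; omega
  | insert a X ha ih =>
    by_cases h : b ≤ ∑ s ∈ X, w s
    · obtain ⟨T, hT, h1⟩ := ih (fun s hs => hμ s (Finset.mem_insert_of_mem hs)) h
      exact ⟨T, hT.trans (Finset.subset_insert _ _), h1⟩
    · refine ⟨insert a X, subset_rfl, hb, ?_, by omega⟩
      have := hμ a (Finset.mem_insert_self _ _)
      rw [Finset.sum_insert ha] at hb ⊢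
      omega

/-- Bins can be filled with items, each bin at least to its size and at most to its cap, such that
the numbers of bins in which two items occur differ by at most one. -/
theorem exists_balanced_packing {ι R : Type*} [DecidableEq ι] [DecidableEq R] (L : Finset R)
    (w : R → ℕ) (μ : ℕ) (hμ : ∀ s ∈ L, w s ≤ μ) (J : Finset ι) (b cap : ι → ℕ)
    (hb : ∀ j ∈ J, b j ≤ ∑ s ∈ L, w s) (hcap : ∀ j ∈ J, b j = 0 ∨ b j + μ ≤ cap j) :
    ∃ T : ι → Finset R,
      (∀ j ∈ J, T j ⊆ L ∧ b j ≤ ∑ s ∈ T j, w s ∧ ∑ s ∈ T j, w s ≤ cap j) ∧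
      ∃ k, ∀ s ∈ L, k ≤ (J.filter fun j => s ∈ T j).card ∧
        (J.filter fun j => s ∈ T j).card ≤ k + 1 := by
  induction J using Finset.induction_on with
  | empty => exact ⟨fun _ => ∅, by simp, 0, by simp⟩
  | insert a J ha ih =>
    obtain ⟨T, hT, k, hk⟩ := ih (fun j hj => hb j (Finset.mem_insert_of_mem hj))
      (fun j hj => hcap j (Finset.mem_insert_of_mem hj))
    have hba := hb a (Finset.mem_insert_self _ _)
    have hca := hcap a (Finset.mem_insert_self _ _)
    suffices h : ∃ U ⊆ L, b a ≤ ∑ s ∈ U, w s ∧ ∑ s ∈ U, w s ≤ cap a ∧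
        ∃ k, ∀ s ∈ L, k ≤ (J.filter fun j => s ∈ T j).card + (if s ∈ U then 1 else 0) ∧
        (J.filter fun j => s ∈ T j).card + (if s ∈ U then 1 else 0) ≤ k + 1 by
      obtain ⟨U, hU, h1, h2, k', hk'⟩ := h
      have hne : ∀ j ∈ J, j ≠ a := fun j hj h => ha (h ▸ hj)
      refine ⟨Function.update T a U, ?_, k', fun s hs => ?_⟩
      · intro j hj
        rcases Finset.mem_insert.1 hj with rfl | hj
        · simpa using ⟨hU, h1, h2⟩
        · simpa [Function.update_of_ne (hne j hj)] using hT j hj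
      · have : ((insert a J).filter fun j => s ∈ Function.update T a U j).card =
            (J.filter fun j => s ∈ T j).card + (if s ∈ U then 1 else 0) := by
          have h3 : (J.filter fun j => s ∈ Function.update T a U j) =
              J.filter fun j => s ∈ T j :=
            Finset.filter_congr fun j hj => by rw [Function.update_of_ne (hne j hj)]
          rw [Finset.filter_insert, h3]
          simp only [Function.update_self]
          split_ifs
          · rw [Finset.card_insert_of_notMem (by simp [ha])]
          · rfl
        rw [this]
        exact hk' s hs
    -- `A` holds the least used items. The new bin takes from these first; only if all of them do
    -- not suffice is it topped up from the others, and then the minimum rises to `k + 1`.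
    set A := L.filter fun s => (J.filter fun j => s ∈ T j).card = k with hA
    have hAL : A ⊆ L := Finset.filter_subset _ _
    by_cases h : b a ≤ ∑ s ∈ A, w s
    · obtain ⟨U, hU, h1, h2, h3⟩ :=
        exists_subset_sum_between w μ A (fun s hs => hμ s (hAL hs)) _ h
      refine ⟨U, hU.trans hAL, h1, ?_, k, fun s hs => ?_⟩
      · rcases hca with h0 | h0
        · simp [h3 h0]
        · omega
      · have := hk s hs
        split_ifs with hsU
        · have := (Finset.mem_filter.1 (hU hsU)).2
          omega
        · omega
    · have h4 := Finset.sum_sdiff (f := w) hAL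
      obtain ⟨U, hU, h1, h2, h3⟩ := exists_subset_sum_between w μ (L \ A)
        (fun s hs => hμ s (Finset.mem_sdiff.1 hs).1) (b a - ∑ s ∈ A, w s) (by omega)
      have hd : Disjoint A U := Finset.disjoint_left.2 fun s hs hs' =>
        (Finset.mem_sdiff.1 (hU hs')).2 hs
      refine ⟨A ∪ U, Finset.union_subset hAL (hU.trans Finset.sdiff_subset), ?_, ?_, k + 1,
        fun s hs => ?_⟩
      · rw [Finset.sum_union hd]; omega
      · rw [Finset.sum_union hd]; omega
      · have h5 := hk s hs
        by_cases hsA : s ∈ A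
        · have := (Finset.mem_filter.1 hsA).2
          simp only [Finset.mem_union, hsA, true_or, if_true]
          omega
        · have : (J.filter fun j => s ∈ T j).card ≠ k := fun h => hsA (by simp [hA, hs, h])
          split_ifs <;> omega

/-- Double counting: every item occurs at least `k` times, so `k` times the total weight is at most
the sum of the caps. Hence `k < u`, and the maximum `k + 1` is at most `u`. -/
theorem exists_packing {ι R : Type*} [DecidableEq ι] [DecidableEq R] (L : Finset R)
    (w : R → ℕ) (μ : ℕ) (hμ : ∀ s ∈ L, w s ≤ μ) (J : Finset ι) (b cap : ι → ℕ)
    (hb : ∀ j ∈ J, b j ≤ ∑ s ∈ L, w s) (hcap : ∀ j ∈ J, b j = 0 ∨ b j + μ ≤ cap j)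
    (u : ℕ) (hu : ∑ j ∈ J, cap j < u * ∑ s ∈ L, w s) :
    ∃ T : ι → Finset R, (∀ j ∈ J, T j ⊆ L ∧ b j ≤ ∑ s ∈ T j, w s) ∧
      ∀ s ∈ L, (J.filter fun j => s ∈ T j).card ≤ u := by
  obtain ⟨T, hT, k, hk⟩ := exists_balanced_packing L w μ hμ J b cap hb hcap
  refine ⟨T, fun j hj => ⟨(hT j hj).1, (hT j hj).2.1⟩, fun s hs => ?_⟩
  have h1 : k * ∑ s ∈ L, w s ≤ ∑ j ∈ J, cap j := by
    calc k * ∑ s ∈ L, w s = ∑ s ∈ L, k * w s := Finset.mul_sum _ _ _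
      _ ≤ ∑ s ∈ L, (J.filter fun j => s ∈ T j).card * w s :=
        Finset.sum_le_sum fun s hs => Nat.mul_le_mul_right _ (hk s hs).1
      _ = ∑ s ∈ L, ∑ j ∈ J, if s ∈ T j then w s else 0 := by
        refine Finset.sum_congr rfl fun s _ => ?_
        rw [← Finset.sum_filter, Finset.sum_const, smul_eq_mul]
      _ = ∑ j ∈ J, ∑ s ∈ L, if s ∈ T j then w s else 0 := Finset.sum_comm
      _ ≤ ∑ j ∈ J, cap j := by
        refine Finset.sum_le_sum fun j hj => ?_
        rw [← Finset.sum_filter, Finset.filter_mem_eq_inter, Finset.inter_eq_right.2 (hT j hj).1]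
        exact (hT j hj).2.2
  have h2 : k < u := lt_of_mul_lt_mul_right (h1.trans_lt hu) (Nat.zero_le _)
  have := (hk s hs).2
  omega

/-- A set can be coloured such that the elements without colour weigh at most `σ`, and the elements
of colour `r` at most `2 * e r`, as soon as the whole set weighs at most `σ + ∑ e r`. -/
theorem exists_coloring_sum_le {R : Type*} [DecidableEq R] (v : R → ℕ) (μ : ℕ) (e : R → ℕ) (σ : ℕ)
    (Q : Finset R) (hQ : ∀ r ∈ Q, μ ≤ e r) (X : Finset R) (hX : ∀ s ∈ X, v s ≤ μ)
    (h : ∑ s ∈ X, v s ≤ σ + ∑ r ∈ Q, e r) :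
    ∃ g : R → Option R, (∀ s ∈ X, ∀ r, g s = some r → r ∈ Q) ∧
      ∑ s ∈ X.filter (fun s => g s = none), v s ≤ σ ∧
      ∀ r ∈ Q, ∑ s ∈ X.filter (fun s => g s = some r), v s ≤ 2 * e r := by
  induction Q using Finset.induction_on generalizing X with
  | empty => exact ⟨fun _ => none, by simp, by simpa using h, by simp⟩
  | insert a Q ha ih =>
    have hea := hQ a (Finset.mem_insert_self _ _)
    rw [Finset.sum_insert ha] at h
    -- Colour `a` takes weight `e a`, or everything if less is left. The overshoot is below `μ ≤ e
    -- a`, whence the factor 2.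
    obtain ⟨T, hT, h1, h2, -⟩ :=
      exists_subset_sum_between v μ X hX (min (e a) (∑ s ∈ X, v s)) (min_le_right _ _)
    have h3 := Finset.sum_sdiff (f := v) hT
    obtain ⟨g, hg, hg0, hg1⟩ := ih (fun r hr => hQ r (Finset.mem_insert_of_mem hr)) (X \ T)
      (fun s hs => hX s (Finset.mem_sdiff.1 hs).1) (by omega)
    refine ⟨fun s => if s ∈ T then some a else g s, ?_, ?_, ?_⟩
    · intro s hs r hr
      by_cases hsT : s ∈ T
      · simp only [hsT, if_true, Option.some.injEq] at hr
        simp [hr]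
      · simp only [hsT, if_false] at hr
        exact Finset.mem_insert_of_mem (hg s (Finset.mem_sdiff.2 ⟨hs, hsT⟩) r hr)
    · convert hg0 using 2
      ext s
      by_cases hsT : s ∈ T <;> simp [hsT]
    · intro r hr
      rcases Finset.mem_insert.1 hr with rfl | hr
      · refine (Finset.sum_le_sum_of_subset (t := T) ?_).trans (by omega)
        intro s hs
        obtain ⟨hs, hs'⟩ := Finset.mem_filter.1 hs
        by_contra hsT
        simp only [hsT, if_false] at hs'
        exact ha (hg s (Finset.mem_sdiff.2 ⟨hs, hsT⟩) r hs')
      · have hne : a ≠ r := fun h => ha (h ▸ hr)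
        convert hg1 r hr using 2
        ext s
        by_cases hsT : s ∈ T <;> simp [hsT, hne]

/-! ### Congestion under deviations, splittings and renaming -/

section Profiles

variable {K P R : Type*} [Fintype K] [Fintype P] [DecidableEq R]

theorem congestion_eq_sum (S : K → Finset R) (r : R) :
    congestion S r = ∑ k, if r ∈ S k then 1 else 0 := by
  rw [congestion, Finset.card_filter]

theorem congestion_update [DecidableEq K] (S : K → Finset R) (k : K) (T : Finset R) (r : R) :
    congestion (Function.update S k T) r + (if r ∈ S k then 1 else 0) =
      congestion S r + (if r ∈ T then 1 else 0) := by
  rw [congestion_eq_sum, congestion_eq_sum, ← Finset.add_sum_erase _ _ (Finset.mem_univ k),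
    ← Finset.add_sum_erase (a := k) _ (fun i => if r ∈ S i then 1 else 0) (Finset.mem_univ k)]
  have : ∑ x ∈ Finset.univ.erase k, (if r ∈ Function.update S k T x then 1 else 0) =
      ∑ x ∈ Finset.univ.erase k, if r ∈ S x then 1 else 0 :=
    Finset.sum_congr rfl fun x hx => by rw [Function.update_of_ne (Finset.ne_of_mem_erase hx)]
  rw [this, Function.update_self]
  ring

theorem congestion_le_bottleneck [Fintype R] (S : K → Finset R) (r : R) :
    congestion S r ≤ bottleneck S :=
  Finset.le_sup (f := fun r => congestion S r) (Finset.mem_univ r)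

theorem bottleneck_le_iff [Fintype R] (S : K → Finset R) (n : ℕ) :
    bottleneck S ≤ n ↔ ∀ r, congestion S r ≤ n := by
  simp [bottleneck]

theorem exists_congestion_eq_bottleneck [Fintype R] [Nonempty R] (S : K → Finset R) :
    ∃ r, congestion S r = bottleneck S := by
  obtain ⟨r, -, hr⟩ := Finset.exists_mem_eq_sup Finset.univ Finset.univ_nonempty
    fun r => congestion S r
  exact ⟨r, hr.symm⟩

theorem sum_sum_inter (S : K → Finset R) (H : Finset R) (f : R → ℕ) :
    ∑ k, ∑ r ∈ S k ∩ H, f r = ∑ r ∈ H, congestion S r * f r := by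
  have : ∀ k, ∑ r ∈ S k ∩ H, f r = ∑ r ∈ H, if r ∈ S k then f r else 0 := fun k => by
    rw [← Finset.sum_filter, Finset.filter_mem_eq_inter, Finset.inter_comm]
  simp_rw [this]
  rw [Finset.sum_comm]
  refine Finset.sum_congr rfl fun r _ => ?_
  rw [← Finset.sum_filter, Finset.sum_const, smul_eq_mul, congestion]

/-- The cost after a deviation, in terms of the congestions before. -/
theorem sum_congestion_update_pow [DecidableEq K] (S : K → Finset R) (k : K) (T : Finset R)
    (M : ℕ) :
    ∑ r ∈ T, congestion (Function.update S k T) r ^ M =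
      ∑ r ∈ T ∩ S k, congestion S r ^ M + ∑ r ∈ T \ S k, (congestion S r + 1) ^ M := by
  rw [← Finset.sum_inter_add_sum_sdiff T (S k)]
  congr 1
  · refine Finset.sum_congr rfl fun r hr => ?_
    obtain ⟨h1, h2⟩ := Finset.mem_inter.1 hr
    have := congestion_update S k T r
    simp only [h1, h2, if_true] at this
    rw [show congestion (Function.update S k T) r = congestion S r by omega]
  · refine Finset.sum_congr rfl fun r hr => ?_
    obtain ⟨h1, h2⟩ := Finset.mem_sdiff.1 hr
    have := congestion_update S k T r
    simp only [h1, h2, if_true, if_false] at this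
    rw [show congestion (Function.update S k T) r = congestion S r + 1 by omega]

theorem sum_congestion_le_update_iff [DecidableEq K] (S : K → Finset R) (k : K) (T : Finset R)
    (M : ℕ) :
    ∑ r ∈ S k, congestion S r ^ M ≤ ∑ r ∈ T, congestion (Function.update S k T) r ^ M ↔
      ∑ r ∈ S k \ T, congestion S r ^ M ≤ ∑ r ∈ T \ S k, (congestion S r + 1) ^ M := by
  rw [sum_congestion_update_pow, ← Finset.sum_inter_add_sum_sdiff (S k) T, Finset.inter_comm]
  omega

theorem IsSplitting.congestion_eq {S : P → Finset R} {S' : K → Finset R} {origin : K → P}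
    (h : IsSplitting S S' origin) (r : R) : congestion S' r = congestion S r := by
  classical
  refine Finset.card_bij (fun k _ => origin k) ?_ ?_ ?_
  · intro k hk
    simp only [Finset.mem_filter, Finset.mem_univ, true_and] at hk ⊢
    exact h.1 k hk
  · intro k hk k' hk' he
    simp only [Finset.mem_filter, Finset.mem_univ, true_and] at hk hk'
    exact (h.2 (origin k') r (h.1 k' hk')).unique ⟨he, hk⟩ ⟨rfl, hk'⟩
  · intro i hi
    simp only [Finset.mem_filter, Finset.mem_univ, true_and] at hi
    obtain ⟨k, ⟨hk, hk'⟩, -⟩ := h.2 i r hi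
    exact ⟨k, by simpa using hk', hk⟩

theorem IsSplitting.bottleneck_eq [Fintype R] {S : P → Finset R} {S' : K → Finset R}
    {origin : K → P} (h : IsSplitting S S' origin) : bottleneck S' = bottleneck S := by
  simp only [bottleneck, h.congestion_eq]

theorem congestion_comp_equiv {K' : Type*} [Fintype K'] (Z : K' → Finset R) (e : K ≃ K') (r : R) :
    congestion (Z ∘ e) r = congestion Z r := by
  simp only [congestion_eq_sum, Function.comp]
  exact e.sum_comp fun k => if r ∈ Z k then 1 else 0

theorem bottleneck_comp_equiv {K' : Type*} [Fintype K'] [Fintype R] (Z : K' → Finset R)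
    (e : K ≃ K') : bottleneck (Z ∘ e) = bottleneck Z := by
  simp only [bottleneck, congestion_comp_equiv]

end Profiles

/-! ### Optimal congestion and Nash inequalities -/

section Games

variable {P R : Type*} [Fintype P] [Fintype R] [DecidableEq R]

theorem IsState.optCongestion_le {G : CongestionGame P R} {S : P → Finset R} (hS : G.IsState S) :
    G.optCongestion ≤ bottleneck S :=
  Nat.sInf_le ⟨S, hS, rfl⟩

theorem exists_bottleneck_eq_optCongestion (G : CongestionGame P R) :
    ∃ S, G.IsState S ∧ bottleneck S = G.optCongestion := by
  choose S hS using G.strategies_nonempty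
  exact Nat.sInf_mem (s := {c | ∃ S, G.IsState S ∧ bottleneck S = c}) ⟨_, S, hS, rfl⟩

theorem le_optCongestion {G : CongestionGame P R} {c : ℕ}
    (h : ∀ S, G.IsState S → c ≤ bottleneck S) : c ≤ G.optCongestion := by
  obtain ⟨S, hS, he⟩ := G.exists_bottleneck_eq_optCongestion
  exact he ▸ h S hS

variable [DecidableEq P]

theorem IsHighestNash.priceOfAnarchy_eq {G : CongestionGame P R} {S : P → Finset R}
    (hS : G.IsHighestNash S) : G.priceOfAnarchy = bottleneck S / G.optCongestion := by
  refine IsGreatest.csSup_eq ⟨⟨S, hS.1, rfl⟩, ?_⟩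
  rintro x ⟨Z, hZ, rfl⟩
  have := hS.2 Z hZ
  gcongr

theorem IsPolynomial.playerCost_eq {G : CongestionGame P R} {M : ℕ} (hG : G.IsPolynomial M)
    (S : P → Finset R) (i : P) : G.playerCost S i = ∑ r ∈ S i, congestion S r ^ M :=
  Finset.sum_congr rfl fun _ _ => hG _

theorem IsNash.sum_sdiff_le {G : CongestionGame P R} {M : ℕ} (hG : G.IsPolynomial M)
    {S : P → Finset R} (hS : G.IsNash S) (i : P) {T : Finset R} (hT : T ∈ G.strategies i) :
    ∑ r ∈ S i \ T, congestion S r ^ M ≤ ∑ r ∈ T \ S i, (congestion S r + 1) ^ M := by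
  have := hS.2 i T hT
  rw [hG.playerCost_eq, hG.playerCost_eq, Function.update_self] at this
  exact (sum_congestion_le_update_iff S i T M).1 this

/-- In a Nash equilibrium, the excess of the total cost on a set of resources is covered by the
other resources. -/
theorem IsNash.sum_congestion_mul_pow_le {G : CongestionGame P R} {M : ℕ} (hG : G.IsPolynomial M)
    {S : P → Finset R} (hS : G.IsNash S) {Y : P → Finset R} (hY : G.IsState Y) (H : Finset R) :
    ∑ r ∈ H, congestion S r * congestion S r ^ M ≤
      ∑ r ∈ H, congestion Y r * (congestion S r + 1) ^ M +
        bottleneck Y * ∑ r ∈ Hᶜ, (congestion S r + 1) ^ M := by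
  have h1 : ∑ r, congestion S r * congestion S r ^ M ≤
      ∑ r, congestion Y r * (congestion S r + 1) ^ M := by
    rw [← sum_sum_inter, ← sum_sum_inter]
    refine Finset.sum_le_sum fun i _ => ?_
    rw [Finset.inter_univ, Finset.inter_univ, ← Finset.sum_inter_add_sum_sdiff (S i) (Y i),
      ← Finset.sum_inter_add_sum_sdiff (Y i) (S i), Finset.inter_comm (Y i)]
    -- On the common resources `S i ∩ Y i` the cost is merely increased from `C_r ^ M` to `(C_r + 1)
    -- ^ M`, which gives a bound uniform over all of `Y i`.
    refine add_le_add (Finset.sum_le_sum fun r _ => ?_) (hS.sum_sdiff_le hG i (hY i))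
    gcongr
    omega
  have h2 : ∑ r ∈ Hᶜ, congestion Y r * (congestion S r + 1) ^ M ≤
      bottleneck Y * ∑ r ∈ Hᶜ, (congestion S r + 1) ^ M := by
    rw [Finset.mul_sum]
    exact Finset.sum_le_sum fun r _ => Nat.mul_le_mul_right _ (congestion_le_bottleneck Y r)
  rw [← Finset.sum_add_sum_compl H, ← Finset.sum_add_sum_compl H
    fun r => congestion Y r * (congestion S r + 1) ^ M] at h1
  omega

end Games

/-! ### Transforms and games with two strategies per player -/

section Transform

variable {P R : Type*} [Fintype P] [Fintype R] [DecidableEq P] [DecidableEq R]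
variable {K : Type*} [Fintype K] [DecidableEq K]

/-- The game `G'` with highest-cost Nash equilibrium `S'` arises from `G` and `S` by splitting
players, and its optimal congestion is at least that of `G` and at most seven times as large. -/
structure IsTransform (M : ℕ) (G : CongestionGame P R) (S : P → Finset R)
    (G' : CongestionGame K R) (S' : K → Finset R) (origin : K → P) : Prop where
  isSplitting : IsSplitting S S' origin
  isPolynomial : G'.IsPolynomial M
  isHighestNash : G'.IsHighestNash S'
  onlyTypeAAbove : OnlyTypeAAbove S' (max (2 * M) (3 * G.optCongestion))
  le_opt : G.optCongestion ≤ G'.optCongestion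
  opt_le : G'.optCongestion ≤ 7 * G.optCongestion

/-- The game with its players renamed along an equivalence. -/
def reindex {K' : Type*} (G : CongestionGame K R) (e : K ≃ K') : CongestionGame K' R where
  strategies k := G.strategies (e.symm k)
  strategies_nonempty _ := G.strategies_nonempty _
  delay := G.delay

variable {K' : Type*} [Fintype K'] [DecidableEq K']

theorem isState_reindex_iff (G : CongestionGame K R) (e : K ≃ K') (Z : K' → Finset R) :
    (G.reindex e).IsState Z ↔ G.IsState (Z ∘ e) := by
  constructor
  · intro h k
    simpa [reindex] using h (e k)
  · intro h k
    simpa [reindex] using h (e.symm k)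

theorem isNash_reindex_iff (G : CongestionGame K R) (e : K ≃ K') (Z : K' → Finset R) :
    (G.reindex e).IsNash Z ↔ G.IsNash (Z ∘ e) := by
  have hc : ∀ (Y : K' → Finset R) k, (G.reindex e).playerCost Y (e k) =
      G.playerCost (Y ∘ e) k := fun Y k => by
    simp only [playerCost, congestion_comp_equiv, reindex, Function.comp]
  have hu : ∀ k T, Function.update Z (e k) T ∘ e = Function.update (Z ∘ e) k T := fun k T => by
    ext1 j
    by_cases h : j = k
    · subst h; simp
    · simp [Function.update_of_ne h, Function.update_of_ne (e.injective.ne h)]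
  rw [IsNash, IsNash, isState_reindex_iff, ← e.forall_congr_right]
  simp only [hc, hu]
  simp [reindex]

theorem optCongestion_reindex (G : CongestionGame K R) (e : K ≃ K') :
    (G.reindex e).optCongestion = G.optCongestion := by
  refine le_antisymm (le_optCongestion fun S hS => ?_) (le_optCongestion fun S hS => ?_)
  · rw [← bottleneck_comp_equiv S e.symm]
    refine IsState.optCongestion_le ((isState_reindex_iff G e _).2 ?_)
    simpa [Function.comp_def] using hS
  · rw [← bottleneck_comp_equiv S e]
    exact IsState.optCongestion_le ((isState_reindex_iff G e _).1 hS)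

theorem IsTransform.reindex {M : ℕ} {G : CongestionGame P R} {S : P → Finset R}
    {G' : CongestionGame K R} {S' : K → Finset R} {origin : K → P}
    (h : IsTransform M G S G' S' origin) (e : K ≃ K') :
    IsTransform M G S (G'.reindex e) (S' ∘ e.symm) (origin ∘ e.symm) where
  isSplitting := by
    refine ⟨fun k => h.1.1 _, fun i r hr => ?_⟩
    obtain ⟨k, hk, hk'⟩ := h.1.2 i r hr
    exact ⟨e k, by simpa using hk, fun j hj => by rw [← hk' _ hj, e.apply_symm_apply]⟩
  isPolynomial := h.isPolynomial
  isHighestNash := by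
    have hc : (S' ∘ e.symm) ∘ e = S' := by ext1; simp
    refine ⟨(isNash_reindex_iff _ _ _).2 (by rw [hc]; exact h.isHighestNash.1), fun Z hZ => ?_⟩
    rw [bottleneck_comp_equiv, ← bottleneck_comp_equiv Z e]
    exact h.isHighestNash.2 _ ((isNash_reindex_iff _ _ _).1 hZ)
  onlyTypeAAbove r hr k hk := by
    rw [congestion_comp_equiv] at hr
    exact h.onlyTypeAAbove r hr _ hk
  le_opt := by rw [optCongestion_reindex]; exact h.le_opt
  opt_le := by rw [optCongestion_reindex]; exact h.opt_le

theorem IsTransform.exists_fin [Nonempty K] {M : ℕ} {G : CongestionGame P R}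
    (hG : G.IsPolynomial M) {S : P → Finset R} (hS : G.IsHighestNash S)
    {G₁ : CongestionGame K R} {S₁ : K → Finset R} {origin₁ : K → P}
    (h₁ : IsTransform M G S G₁ S₁ origin₁) :
    ∃ (n : ℕ) (G' : CongestionGame (Fin n) R) (S' : Fin n → Finset R) (origin : Fin n → P),
      0 < n ∧ IsSplitting S S' origin ∧ G'.IsPolynomial M ∧ G'.IsHighestNash S' ∧
      (∀ r, congestion S' r = congestion S r) ∧
      OnlyTypeAAbove S' (max (2 * M) (3 * G.optCongestion)) ∧
      Dominates 7 G G' ∧ G.priceOfAnarchy ≤ 7 * G'.priceOfAnarchy := by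
  have h := h₁.reindex (Fintype.equivFin K)
  have hle : ((G₁.reindex (Fintype.equivFin K)).optCongestion : ℝ) ≤ 7 * G.optCongestion := by
    exact_mod_cast h.opt_le
  refine ⟨_, _, _, _, Fintype.card_pos, h.isSplitting, h.isPolynomial, h.isHighestNash,
    h.isSplitting.congestion_eq, h.onlyTypeAAbove, ⟨by norm_num, le_rfl, ?_,
    ⟨S, _, hS, h.isHighestNash, h.isSplitting.bottleneck_eq⟩, h.le_opt, hle⟩, ?_⟩
  · funext c
    rw [h.isPolynomial c, hG c]
  · rw [hS.priceOfAnarchy_eq, h.isHighestNash.priceOfAnarchy_eq, h.isSplitting.bottleneck_eq]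
    rcases Nat.eq_zero_or_pos G.optCongestion with h0 | h0
    · rw [h0]
      simp only [Nat.cast_zero, div_zero]
      positivity
    · have h1 : (0 : ℝ) < (G₁.reindex (Fintype.equivFin K)).optCongestion := by
        exact_mod_cast h0.trans_le h.le_opt
      have h2 : (0 : ℝ) < G.optCongestion := by exact_mod_cast h0
      rw [← mul_div_assoc, div_le_div_iff₀ h2 h1]
      nlinarith [Nat.cast_nonneg (α := ℝ) (bottleneck S)]

/-- The polynomial game of degree `M` in which player `k` can choose between `base k` and
`alt k`. -/
def twoStrategyGame (base alt : K → Finset R) (M : ℕ) : CongestionGame K R where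
  strategies k := {base k, alt k}
  strategies_nonempty _ := Finset.insert_nonempty _ _
  delay c := c ^ M

/-- A game in which every player can choose between two strategies is a transform of `G`, provided
that `base` is an equilibrium that splits `S`, that no resource can be overloaded by the players
outside `A`, and that players in `A` have a single base resource, which cannot be overloaded. -/
theorem isTransform_twoStrategyGame {M : ℕ} (hM : 1 ≤ M) {G : CongestionGame P R}
    {S : P → Finset R} {base alt : K → Finset R} {origin : K → P} (A : K → Prop)
    (hsplit : IsSplitting S base origin)
    (htype : ∀ k, ∀ r ∈ base k, max (2 * M) (3 * G.optCongestion) < congestion S r →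
      (base k).card = 1)
    (hnash : ∀ k, ∑ r ∈ base k \ alt k, congestion S r ^ M ≤
      ∑ r ∈ alt k \ base k, (congestion S r + 1) ^ M)
    (hA : ∀ k, A k → ∃ r, base k = {r} ∧
      ∀ Z, (twoStrategyGame base alt M).IsState Z → congestion Z r ≤ bottleneck S)
    (hB : ∀ r (U : Finset K), (∀ k ∈ U, r ∈ base k ∨ (¬ A k ∧ r ∈ alt k)) →
      U.card ≤ bottleneck S)
    (halt : ∀ r, congestion alt r ≤ 7 * G.optCongestion)
    (hpin : ∃ r, ∃ U : Finset K, (∀ k ∈ U, r ∈ base k ∧ r ∈ alt k) ∧ G.optCongestion ≤ U.card) :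
    IsTransform M G S (twoStrategyGame base alt M) base origin := by
  have hpoly : (twoStrategyGame base alt M).IsPolynomial M := fun c => rfl
  have hstate : ∀ Z, (twoStrategyGame base alt M).IsState Z ↔ ∀ k, Z k = base k ∨ Z k = alt k :=
    fun Z => by simp [IsState, twoStrategyGame]
  refine ⟨hsplit, hpoly, ⟨⟨(hstate _).2 fun k => Or.inl rfl, fun k T hT => ?_⟩, fun Z hZ => ?_⟩,
    fun r hr k hk => ?_, le_optCongestion fun Z hZ => ?_, ?_⟩
  · rw [hpoly.playerCost_eq, hpoly.playerCost_eq, Function.update_self]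
    rcases (show T = base k ∨ T = alt k by simpa [twoStrategyGame] using hT) with rfl | rfl
    · simp
    · rw [sum_congestion_le_update_iff]
      simpa only [hsplit.congestion_eq] using hnash k
  · rw [hsplit.bottleneck_eq, bottleneck_le_iff]
    intro r
    have hZs := (hstate Z).1 hZ.1
    by_contra! hlt
    -- By `hB`, an overloaded resource must be used by a player of `A` on its alternative.
    obtain ⟨k, hk⟩ : ∃ k, r ∈ Z k ∧ ¬ (r ∈ base k ∨ (¬ A k ∧ r ∈ alt k)) := by
      by_contra! hcon
      refine absurd (hB r _ fun k hk => ?_) hlt.not_ge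
      exact hcon k (by simpa using hk)
    have hZk : Z k = alt k := (hZs k).resolve_left fun h => hk.2 (Or.inl (h ▸ hk.1))
    have hAk : A k := by
      by_contra h
      exact hk.2 (Or.inr ⟨h, hZk ▸ hk.1⟩)
    obtain ⟨r', hr', hle⟩ := hA k hAk
    have hdev := hZ.2 k (base k) (by simp [twoStrategyGame])
    rw [hpoly.playerCost_eq, hpoly.playerCost_eq, Function.update_self, hr',
      Finset.sum_singleton] at hdev
    -- The state after the return to `r'` is covered by `hA` too, so the returning player pays at
    -- most `C(S) ^ M`, less than it pays on `r` alone.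
    have h1 := hle (Function.update Z k {r'}) ((hstate _).2 fun j => by
      by_cases h : j = k
      · subst h; simp [hr']
      · simpa [Function.update_of_ne h] using hZs j)
    have h2 : congestion Z r ^ M ≤ ∑ r ∈ Z k, congestion Z r ^ M :=
      Finset.single_le_sum (f := fun r => congestion Z r ^ M) (fun _ _ => Nat.zero_le _) hk.1
    have h3 := Nat.pow_le_pow_left h1 M
    have h4 := Nat.pow_lt_pow_left hlt (by omega : M ≠ 0)
    omega
  · rw [hsplit.congestion_eq] at hr
    exact htype k r hk hr
  -- The players of `U` use `r` under both strategies, hence in every state.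
  · obtain ⟨r, U, hU, hcard⟩ := hpin
    refine hcard.trans ((Finset.card_le_card fun k hk => ?_).trans (congestion_le_bottleneck Z r))
    rcases (hstate Z).1 hZ k with h | h
    · simpa [h] using (hU k hk).1
    · simpa [h] using (hU k hk).2
  · exact (IsState.optCongestion_le ((hstate _).2 fun k => Or.inr rfl)).trans
      ((bottleneck_le_iff _ _).2 halt)

end Transform

/-! ### Alternatives for the players on high resources -/

section Threshold

variable {P R : Type*} [Fintype P] [Fintype R] [DecidableEq P] [DecidableEq R]

/-- On every resource `r` of congestion above `t` all but `7 * c` players can be given an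
alternative consisting of resources of congestion at most `t`, such that no such resource is used
by more than `2 * c` alternatives. The set `Q r` consists of the players that stay. -/
theorem exists_high_alternatives (S : P → Finset R) (M t c : ℕ) (hc : 1 ≤ c)
    (hex : ∑ r with t < congestion S r, congestion S r * congestion S r ^ M ≤
      ∑ r with t < congestion S r, c * (congestion S r + 1) ^ M +
        c * ∑ r with congestion S r ≤ t, (congestion S r + 1) ^ M)
    (hhigh : ∀ n, t < n → c * (n + 1) ^ M ≤ n * n ^ M)
    (htop : ∀ n, t < n → 7 * c < n → (n + 1) ^ M ≤ 6 * n ^ M)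
    (hne : ∃ r, t < congestion S r ∧ 7 * c < congestion S r) :
    ∃ (Q : R → Finset P) (T : P × R → Finset R),
      (∀ r, (∀ i ∈ Q r, r ∈ S i) ∧ (Q r).card = min (7 * c) (congestion S r)) ∧
      (∀ p, p.2 ∈ S p.1 → t < congestion S p.2 → p.1 ∉ Q p.2 →
        (∀ s ∈ T p, congestion S s ≤ t) ∧
          congestion S p.2 ^ M ≤ ∑ s ∈ T p, (congestion S s + 1) ^ M) ∧
      ∀ s, congestion S s ≤ t → (Finset.univ.filter fun p : P × R =>
        (p.2 ∈ S p.1 ∧ t < congestion S p.2 ∧ p.1 ∉ Q p.2) ∧ s ∈ T p).card ≤ 2 * c := by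
  set W := ∑ r with congestion S r ≤ t, (congestion S r + 1) ^ M
  have hQ : ∀ r, ∃ Q : Finset P, Q ⊆ (Finset.univ.filter fun i => r ∈ S i) ∧
      Q.card = min (7 * c) (congestion S r) := fun r =>
    Finset.exists_subset_card_eq (min_le_right _ _)
  choose Q hQ hQc using hQ
  -- The excess of `r`. The subtraction does not truncate on high resources, by `hhigh`.
  set δ : R → ℕ := fun r =>
    congestion S r * congestion S r ^ M - c * (congestion S r + 1) ^ M
  have hδ : ∑ r with t < congestion S r, δ r ≤ c * W := by
    have : ∑ r with t < congestion S r, congestion S r * congestion S r ^ M =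
        ∑ r with t < congestion S r, δ r +
          ∑ r with t < congestion S r, c * (congestion S r + 1) ^ M := by
      rw [← Finset.sum_add_distrib]
      refine Finset.sum_congr rfl fun r hr => ?_
      exact (Nat.sub_add_cancel (hhigh _ (Finset.mem_filter.1 hr).2)).symm
    omega
  -- With n = C_r, `htop` gives c(n + 1)^M ≤ 6c n^M, so δ_r ≥ (n - 7c) n^M + c n^M: pinning 7c
  -- players leaves c n^M to spare. This makes the bound on the caps strict and shows that a single
  -- demand n^M fits into the low weight.
  have hδ1 : ∀ r, t < congestion S r → 7 * c < congestion S r →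
      c * congestion S r ^ M ≤ δ r ∧ (congestion S r - 7 * c) * congestion S r ^ M < δ r := by
    intro r h1 h2
    have h3 := Nat.mul_le_mul_left c (htop _ h1 h2)
    obtain ⟨d, hd⟩ := Nat.exists_eq_add_of_lt h2
    have h4 : 0 < c * congestion S r ^ M := by
      have : 0 < congestion S r := by omega
      positivity
    have h5 : congestion S r * congestion S r ^ M =
        7 * (c * congestion S r ^ M) + (congestion S r - 7 * c) * congestion S r ^ M := by
      rw [← mul_assoc, ← add_mul, Nat.add_sub_cancel' h2.le]
    have h6 : c * (6 * congestion S r ^ M) = 6 * (c * congestion S r ^ M) := by ring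
    simp only [δ]
    omega
  set J : Finset (P × R) := Finset.univ.filter fun p : P × R =>
    p.2 ∈ S p.1 ∧ t < congestion S p.2 ∧ p.1 ∉ Q p.2 with hJ
  have hmem : ∀ p, p ∈ J ↔ p.2 ∈ S p.1 ∧ t < congestion S p.2 ∧ p.1 ∉ Q p.2 := by simp [hJ]
  have hJ7 : ∀ p ∈ J, 7 * c < congestion S p.2 := by
    intro p hp
    by_contra! h
    obtain ⟨h1, -, h3⟩ := (hmem p).1 hp
    have := Finset.eq_of_subset_of_card_le (hQ p.2) (by rw [hQc, min_eq_right h]; rfl)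
    exact h3 (by rw [this]; simpa using h1)
  have hcap : ∑ p ∈ J, 2 * congestion S p.2 ^ M < 2 * c * W := by
    have h1 : ∑ p ∈ J, 2 * congestion S p.2 ^ M =
        ∑ r with t < congestion S r, 2 * ((congestion S r - 7 * c) * congestion S r ^ M) := by
      rw [hJ, Finset.sum_filter, Fintype.sum_prod_type_right, Finset.sum_filter]
      refine Finset.sum_congr rfl fun r _ => ?_
      rw [← Finset.sum_filter]
      simp only [Finset.sum_const, smul_eq_mul]
      by_cases ht : t < congestion S r
      · simp only [ht, true_and, if_true]
        have : (Finset.univ.filter fun i => r ∈ S i ∧ i ∉ Q r) =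
            (Finset.univ.filter fun i => r ∈ S i) \ Q r := by
          ext i; simp
        rw [this, Finset.card_sdiff_of_subset (hQ r), hQc]
        change (congestion S r - _) * _ = _
        rw [show congestion S r - min (7 * c) (congestion S r) = congestion S r - 7 * c by omega]
        ring
      · simp [ht]
    have h2 : ∑ r with t < congestion S r, (congestion S r - 7 * c) * congestion S r ^ M <
        ∑ r with t < congestion S r, δ r := by
      refine Finset.sum_lt_sum (fun r hr => ?_) ?_
      · rcases le_or_gt (congestion S r) (7 * c) with h | h
        · simp [Nat.sub_eq_zero_of_le h]
        · exact (hδ1 r (Finset.mem_filter.1 hr).2 h).2.le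
      · obtain ⟨r, hr, hr'⟩ := hne
        exact ⟨r, by simpa using hr, (hδ1 r hr hr').2⟩
    rw [h1, ← Finset.mul_sum, mul_assoc]
    omega
  obtain ⟨T, hT, hu⟩ := exists_packing (Finset.univ.filter fun r => congestion S r ≤ t)
    (fun r => (congestion S r + 1) ^ M) ((t + 1) ^ M)
    (fun s hs => Nat.pow_le_pow_left (Nat.succ_le_succ (Finset.mem_filter.1 hs).2) M) J
    (fun p => congestion S p.2 ^ M) (fun p => 2 * congestion S p.2 ^ M)
    (fun p hp => by
      have h1 := (hδ1 p.2 ((hmem p).1 hp).2.1 (hJ7 p hp)).1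
      have h2 : δ p.2 ≤ ∑ r with t < congestion S r, δ r :=
        Finset.single_le_sum (f := δ) (fun _ _ => Nat.zero_le _)
          (by simpa using ((hmem p).1 hp).2.1)
      exact Nat.le_of_mul_le_mul_left (h1.trans (h2.trans hδ)) hc)
    -- A low item weighs at most `(t + 1) ^ M`, which is at most the demand of a high resource;
    -- hence caps of twice the demand suffice.
    (fun p hp => Or.inr (by
      have : (t + 1) ^ M ≤ congestion S p.2 ^ M := Nat.pow_le_pow_left ((hmem p).1 hp).2.1 M
      omega)) (2 * c) hcap
  refine ⟨Q, T, fun r => ⟨fun i hi => by simpa using hQ r hi, hQc r⟩, fun p h1 h2 h3 => ?_,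
    fun s hs => ?_⟩
  · obtain ⟨h4, h5⟩ := hT p ((hmem p).2 ⟨h1, h2, h3⟩)
    exact ⟨fun s hs => by simpa using h4 hs, h5⟩
  · have := hu s (by simpa using hs)
    rwa [hJ, Finset.filter_filter] at this

theorem congestion_sum {K₁ K₂ : Type*} [Fintype K₁] [Fintype K₂] (Z : K₁ ⊕ K₂ → Finset R) (r : R) :
    congestion Z r = congestion (fun k => Z (Sum.inl k)) r +
      congestion (fun k => Z (Sum.inr k)) r := by
  simp only [congestion_eq_sum, Fintype.sum_sum_type]

/-- A splitting of the parts of the strategies on the resources of congestion at most `t`, together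
with alternatives on these resources, extends to a transform of the game. -/
theorem exists_isTransform_of_low [Nonempty R] {M : ℕ} (hM : 1 ≤ M) {G : CongestionGame P R}
    (hG : G.IsPolynomial M) {S : P → Finset R} (hS : G.IsNash S) (t : ℕ)
    (hc : 1 ≤ G.optCongestion) (hcS : 7 * G.optCongestion < bottleneck S)
    (htS : t < bottleneck S) (ht : t ≤ max (2 * M) (3 * G.optCongestion))
    (hhigh : ∀ n, t < n → G.optCongestion * (n + 1) ^ M ≤ n * n ^ M)
    (htop : ∀ n, t < n → 7 * G.optCongestion < n → (n + 1) ^ M ≤ 6 * n ^ M)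
    {K : Type*} [Fintype K] [DecidableEq K] (base alt : K → Finset R) (origin : K → P)
    (hsub : ∀ k, ∀ s ∈ base k, s ∈ S (origin k) ∧ congestion S s ≤ t)
    (hsplit : ∀ i, ∀ s ∈ S i, congestion S s ≤ t → ∃! k, origin k = i ∧ s ∈ base k)
    (halt : ∀ k, ∀ s ∈ alt k, congestion S s ≤ t)
    (hnash : ∀ k, ∑ r ∈ base k \ alt k, congestion S r ^ M ≤
      ∑ r ∈ alt k \ base k, (congestion S r + 1) ^ M)
    (huse : ∀ s, congestion alt s ≤ 5 * G.optCongestion)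
    (hpot : ∀ s, congestion S s ≤ t →
      (Finset.univ.filter fun k => s ∈ base k ∨ s ∈ alt k).card ≤ bottleneck S) :
    ∃ (G' : CongestionGame ((P × R) ⊕ K) R) (S' : (P × R) ⊕ K → Finset R)
      (origin' : (P × R) ⊕ K → P), IsTransform M G S G' S' origin' := by
  set c := G.optCongestion with hcdef
  obtain ⟨Y, hY, hYc⟩ := G.exists_bottleneck_eq_optCongestion
  rw [← hcdef] at hYc
  obtain ⟨r₀, hr₀⟩ := exists_congestion_eq_bottleneck S
  obtain ⟨Q, T, hQ, hT, hu⟩ := exists_high_alternatives S M t c hc (by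
      have h1 := hS.sum_congestion_mul_pow_le hG hY (Finset.univ.filter fun r => t < congestion S r)
      have h2 : (Finset.univ.filter fun r => t < congestion S r)ᶜ =
          Finset.univ.filter fun r => congestion S r ≤ t := by
        ext; simp
      rw [h2, hYc] at h1
      refine h1.trans (Nat.add_le_add_right (Finset.sum_le_sum fun r _ => ?_) _)
      exact Nat.mul_le_mul_right _ (hYc ▸ congestion_le_bottleneck Y r)) hhigh htop
    ⟨r₀, by omega, by omega⟩
  set J : P × R → Prop := fun p => p.2 ∈ S p.1 ∧ t < congestion S p.2 ∧ p.1 ∉ Q p.2 with hJ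
  have hJd : DecidablePred J := fun p => by rw [hJ]; infer_instance
  -- All pairs serve as player indices; those not on a high resource are dummies with empty
  -- strategies.
  set bA : P × R → Finset R := fun p =>
    if p.2 ∈ S p.1 ∧ t < congestion S p.2 then {p.2} else ∅ with hbA
  have memA : ∀ p r, r ∈ bA p ↔ p.2 = r ∧ r ∈ S p.1 ∧ t < congestion S r := by
    intro p r
    simp only [hbA]
    split_ifs with h
    · simp only [Finset.mem_singleton]
      constructor
      · rintro rfl; exact ⟨rfl, h⟩
      · rintro ⟨rfl, -⟩; rfl
    · simp only [Finset.notMem_empty, false_iff]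
      rintro ⟨rfl, h'⟩; exact h h'
  have bA_J : ∀ p, J p → bA p = {p.2} := fun p hp => by simp [hbA, hp.1, hp.2.1]
  set b : (P × R) ⊕ K → Finset R := Sum.elim bA base with hb
  set a : (P × R) ⊕ K → Finset R := Sum.elim (fun p => if J p then T p else bA p) alt with ha
  set o : (P × R) ⊕ K → P := Sum.elim Prod.fst origin with ho
  have hsp : IsSplitting S b o := by
    refine ⟨?_, fun i r hr => ?_⟩
    · rintro (p | k) s hs
      · exact ((memA p s).1 hs).2.1
      · exact (hsub k s hs).1
    · rcases le_or_gt (congestion S r) t with h | h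
      · obtain ⟨k, hk, hk'⟩ := hsplit i r hr h
        refine ⟨Sum.inr k, hk, ?_⟩
        rintro (p | k') ⟨h1, h2⟩
        · exact absurd ((memA p r).1 h2).2.2 (by omega)
        · rw [hk' k' ⟨h1, h2⟩]
      · refine ⟨Sum.inl (i, r), ⟨rfl, (memA _ _).2 ⟨rfl, hr, h⟩⟩, ?_⟩
        rintro (p | k') ⟨h1, h2⟩
        · have := ((memA p r).1 h2).1
          exact congrArg Sum.inl (Prod.ext h1 this)
        · exact absurd (hsub k' r h2).2 (by omega)
  -- On high resources only pinned players have alternatives, and these equal their base strategies.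
  -- So no state overloads a high resource, and at most 7c alternatives use it.
  have alt_high : ∀ k r, t < congestion S r → r ∈ a k → r ∈ b k ∧ ∃ i ∈ Q r, k = Sum.inl (i, r) := by
    rintro (p | k) r hr hk
    · by_cases hp : J p
      · simp only [ha, Sum.elim_inl, hp, if_true] at hk
        exact absurd ((hT p hp.1 hp.2.1 hp.2.2).1 r hk) (by omega)
      · simp only [ha, Sum.elim_inl, hp, if_false] at hk
        refine ⟨hk, p.1, ?_, ?_⟩
        · obtain ⟨rfl, h1, h2⟩ := (memA p r).1 hk
          by_contra h3
          exact hp ⟨h1, h2, h3⟩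
        · rw [← ((memA p r).1 hk).1]
    · exact absurd (halt k r hk) (by omega)
  refine ⟨twoStrategyGame b a M, b, o, isTransform_twoStrategyGame hM
    (fun k => ∃ p, J p ∧ k = Sum.inl p) hsp ?_ ?_ ?_ ?_ ?_ ?_⟩
  · rintro (p | k) r hr hlt
    · obtain ⟨rfl, h1⟩ := (memA p r).1 hr
      simp [hb, hbA, h1]
    · exact absurd (hsub k r hr).2 (by omega)
  · rintro (p | k)
    · by_cases hp : J p
      · have h1 := hT p hp.1 hp.2.1 hp.2.2
        have h2 : p.2 ∉ T p := fun h => absurd (h1.1 _ h) (by have := hp.2.1; omega)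
        simp only [hb, ha, Sum.elim_inl, hp, if_true, bA_J p hp]
        rw [Finset.sdiff_eq_self_of_disjoint (Finset.disjoint_singleton_right.2 h2), Finset.sdiff_eq_self_of_disjoint
          (Finset.disjoint_singleton_left.2 h2), Finset.sum_singleton]
        exact h1.2
      · simp [hb, ha, hp]
    · exact hnash k
  · rintro k ⟨p, hp, rfl⟩
    refine ⟨p.2, bA_J p hp, fun Z hZ => ?_⟩
    refine le_trans (Finset.card_le_card fun k hk => ?_)
      ((hsp.congestion_eq p.2).le.trans (congestion_le_bottleneck S p.2))
    simp only [Finset.mem_filter, Finset.mem_univ, true_and] at hk ⊢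
    rcases (show Z k = b k ∨ Z k = a k by simpa [twoStrategyGame] using hZ k) with h | h
    · exact h ▸ hk
    · exact (alt_high k p.2 hp.2.1 (h ▸ hk)).1
  · intro r U hU
    rcases le_or_gt (congestion S r) t with h | h
    · refine le_trans ?_ (hpot r h)
      rw [← Finset.card_map Function.Embedding.inr (α := K) (β := (P × R) ⊕ K)]
      refine Finset.card_le_card fun k hk => ?_
      rcases k with p | k
      · exfalso
        have h1 : r ∉ bA p := fun h' => absurd ((memA p r).1 h').2.2 (by omega)
        rcases hU _ hk with h2 | ⟨h2, h3⟩
        · exact h1 h2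
        · have hp : ¬ J p := fun hp => h2 ⟨p, hp, rfl⟩
          simp only [ha, Sum.elim_inl, hp, if_false] at h3
          exact h1 h3
      · have : r ∈ base k ∨ r ∈ alt k := (hU _ hk).imp id And.right
        simpa using this
    · refine le_trans (Finset.card_le_card fun k hk => ?_)
        ((hsp.congestion_eq r).le.trans (congestion_le_bottleneck S r))
      simp only [Finset.mem_filter, Finset.mem_univ, true_and]
      rcases hU k hk with h1 | ⟨-, h1⟩
      · exact h1
      · exact (alt_high k r h h1).1
  · intro r
    rcases le_or_gt (congestion S r) t with h | h
    · rw [congestion_sum]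
      have h1 : congestion (fun k => a (Sum.inl k)) r ≤ 2 * c := by
        refine le_trans (Finset.card_le_card fun p hp => ?_) (hu r h)
        simp only [ha, Finset.mem_filter, Finset.mem_univ, true_and, Sum.elim_inl] at hp ⊢
        split_ifs at hp with hp'
        · exact ⟨hp', hp⟩
        · exact absurd ((memA p r).1 hp).2.2 (by omega)
      have h2 := huse r
      change congestion (fun k => a (Sum.inl k)) r + congestion alt r ≤ _
      omega
    · refine le_trans (le_trans (Finset.card_le_card (t := (Q r).image fun i => Sum.inl (i, r))
        fun k hk => ?_) Finset.card_image_le) ((hQ r).2.le.trans (min_le_left _ _))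
      simp only [Finset.mem_filter, Finset.mem_univ, true_and] at hk
      obtain ⟨i, hi, rfl⟩ := (alt_high k r h hk).2
      exact Finset.mem_image_of_mem _ hi
  -- The pinned players on a resource of maximal congestion number 7c, since C(S) > 7c.
  · refine ⟨r₀, (Q r₀).image fun i => Sum.inl (i, r₀), fun k hk => ?_, ?_⟩
    · obtain ⟨i, hi, rfl⟩ := Finset.mem_image.1 hk
      have h1 : r₀ ∈ bA (i, r₀) := (memA _ _).2 ⟨rfl, (hQ r₀).1 i hi, by omega⟩
      have h2 : ¬ J (i, r₀) := fun h => h.2.2 hi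
      simpa [hb, ha, h2] using h1
    · rw [Finset.card_image_of_injective _ fun i j h => by simpa using h, (hQ r₀).2]
      omega

end Threshold

/-- (1 + 1/n)^M ≤ e^(M/n) ≤ e^(p/q), and e^(p/q) ≤ a is checked as e^p ≤ a^q with a decimal upper
bound for e. -/
theorem succ_pow_le_mul_pow {n M a : ℕ} (p q : ℕ) (hn : 0 < n) (hq : 0 < q) (h : q * M ≤ p * n)
    (ha : (2.7182818286 : ℝ) ^ p ≤ (a : ℝ) ^ q) : (n + 1) ^ M ≤ a * n ^ M := by
  have hn' : (0 : ℝ) < n := by exact_mod_cast hn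
  have hq' : (0 : ℝ) < q := by exact_mod_cast hq
  have h1 : Real.exp (p / q) ≤ a := by
    refine le_of_pow_le_pow_left₀ hq.ne' (Nat.cast_nonneg a) (le_trans ?_ ha)
    rw [← Real.exp_nat_mul, mul_div_cancel₀ _ hq'.ne', ← mul_one (p : ℝ), Real.exp_nat_mul]
    exact pow_le_pow_left₀ (Real.exp_pos 1).le Real.exp_one_lt_d9.le p
  have h2 : ((1 : ℝ) + 1 / n) ^ M ≤ a := by
    calc ((1 : ℝ) + 1 / n) ^ M ≤ Real.exp (1 / n) ^ M := by
          refine pow_le_pow_left₀ (by positivity) ?_ M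
          rw [add_comm]
          exact Real.add_one_le_exp _
      _ = Real.exp (M / n) := by rw [← Real.exp_nat_mul]; ring_nf
      _ ≤ Real.exp (p / q) := by
          refine Real.exp_le_exp.2 ?_
          rw [div_le_div_iff₀ hn' hq']
          have : (q : ℝ) * M ≤ p * n := by exact_mod_cast h
          linarith
      _ ≤ a := h1
  have h3 : ((n : ℝ) + 1) ^ M = (1 + 1 / n) ^ M * (n : ℝ) ^ M := by
    rw [← mul_pow]
    congr 1
    field_simp
  have h4 : ((n : ℝ) + 1) ^ M ≤ a * (n : ℝ) ^ M := by
    rw [h3]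
    exact mul_le_mul_of_nonneg_right h2 (by positivity)
  exact_mod_cast h4

/-- One side is filled greedily to two fifths of the weight W, rounded up. The overshoot is below μ
≤ W/5, so the other side also keeps two fifths. -/
theorem exists_balanced_bipartition {R : Type*} [DecidableEq R] (L : Finset R) (w : R → ℕ) (μ : ℕ)
    (hμ : ∀ s ∈ L, w s ≤ μ) (hμ0 : 0 < μ) (h : 5 * μ ≤ ∑ s ∈ L, w s) :
    ∃ side : R → Bool, ∀ b, 2 * ∑ s ∈ L, w s ≤ 5 * ∑ s ∈ L with side s = b, w s := by
  obtain ⟨T, hT, h1, h2, -⟩ := exists_subset_sum_between w μ L hμ ((2 * ∑ s ∈ L, w s + 4) / 5)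
    (by omega)
  have h3 := Finset.sum_sdiff (f := w) hT
  refine ⟨fun s => decide (s ∈ T), fun b => ?_⟩
  cases b
  · have : (L.filter fun s => decide (s ∈ T) = false) = L \ T := by ext; simp
    rw [this]
    omega
  · have : (L.filter fun s => decide (s ∈ T) = true) = T := by
      ext s; simpa using fun hs => hT hs
    rw [this]
    omega

/-! ### Alternatives for the low parts, and the case distinction -/

section Threshold

variable {P R : Type*} [Fintype P] [Fintype R] [DecidableEq P] [DecidableEq R]

/-- If the total weight of the resources of congestion above `t` is small, then the parts of the
strategies on the other resources can be split and given alternatives on the other resources: one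
part of each player uses these resources as in `Y`, and the parts indexed by `(i, r, b)` replace
the resource `r` of `Y i`. -/
theorem exists_low_alternatives {M t c : ℕ} (hc : 1 ≤ c) {S Y : P → Finset R}
    (hY : ∀ r, congestion Y r ≤ c)
    (hnash : ∀ i, ∑ r ∈ S i \ Y i, congestion S r ^ M ≤
      ∑ r ∈ Y i \ S i, (congestion S r + 1) ^ M)
    (hne : ∃ r, t < congestion S r)
    (hW : 5 * ∑ r with t < congestion S r, (congestion S r + 1) ^ M ≤
      ∑ r with congestion S r ≤ t, (congestion S r + 1) ^ M) :
    ∃ (base alt : P ⊕ (P × R × Bool) → Finset R) (origin : P ⊕ (P × R × Bool) → P),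
      (∀ k, ∀ s ∈ base k, s ∈ S (origin k) ∧ congestion S s ≤ t) ∧
      (∀ i, ∀ s ∈ S i, congestion S s ≤ t → ∃! k, origin k = i ∧ s ∈ base k) ∧
      (∀ k, ∀ s ∈ alt k, congestion S s ≤ t) ∧
      (∀ k, ∑ r ∈ base k \ alt k, congestion S r ^ M ≤
        ∑ r ∈ alt k \ base k, (congestion S r + 1) ^ M) ∧
      ∀ s, congestion alt s ≤ 4 * c := by
  set L : Finset R := Finset.univ.filter fun r => congestion S r ≤ t with hL
  set w : R → ℕ := fun r => (congestion S r + 1) ^ M with hw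
  set v : R → ℕ := fun r => congestion S r ^ M with hv
  have hμ : ∀ s ∈ L, w s ≤ (t + 1) ^ M := fun s hs =>
    Nat.pow_le_pow_left (Nat.succ_le_succ (Finset.mem_filter.1 hs).2) M
  have hμw : ∀ r, t < congestion S r → (t + 1) ^ M ≤ w r := fun r hr =>
    Nat.pow_le_pow_left (by omega) M
  have hwW : ∀ r, t < congestion S r → 5 * w r ≤ ∑ s ∈ L, w s := fun r hr =>
    le_trans (Nat.mul_le_mul_left 5 (Finset.single_le_sum (f := w) (fun _ _ => Nat.zero_le _)
      (by simpa using hr))) hW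
  have hWw : 5 * ∑ r with t < congestion S r, w r ≤ ∑ s ∈ L, w s := hW
  obtain ⟨r₀, hr₀⟩ := hne
  have hμ0 : 0 < (t + 1) ^ M := by positivity
  obtain ⟨side, hside⟩ := exists_balanced_bipartition L w ((t + 1) ^ M) hμ hμ0
    (by have := hμw r₀ hr₀; have := hwW r₀ hr₀; omega)
  -- The Nash inequality against `Y i` pays for `S i \ Y i` with `Y i \ S i`. Low resources left
  -- uncoloured are paid for by the low part of `Y i`; those of colour `r` are charged to the high
  -- resource `r ∈ Y i`.
  have hcol : ∀ i, ∃ g : R → Option R,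
      (∀ s ∈ (S i \ Y i) ∩ L, ∀ r, g s = some r → r ∈ (Y i).filter fun r => t < congestion S r) ∧
      ∑ s ∈ ((S i \ Y i) ∩ L).filter (fun s => g s = none), v s ≤ ∑ s ∈ (Y i \ S i) ∩ L, w s ∧
      ∀ r ∈ (Y i).filter (fun r => t < congestion S r),
        ∑ s ∈ ((S i \ Y i) ∩ L).filter (fun s => g s = some r), v s ≤ 2 * w r := by
    intro i
    refine exists_coloring_sum_le v ((t + 1) ^ M) w _ _
      (fun r hr => hμw r (Finset.mem_filter.1 hr).2) _ (fun s hs => ?_) ?_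
    · exact Nat.pow_le_pow_left
        ((Finset.mem_filter.1 (Finset.mem_inter.1 hs).2).2.trans (Nat.le_succ t)) M
    · refine (Finset.sum_le_sum_of_subset Finset.inter_subset_left).trans ((hnash i).trans ?_)
      rw [← Finset.sum_inter_add_sum_sdiff (Y i \ S i) L]
      refine Nat.add_le_add_left (Finset.sum_le_sum_of_subset fun s hs => ?_) _
      simp only [hL, Finset.mem_sdiff, Finset.mem_filter, Finset.mem_univ, true_and] at hs ⊢
      exact ⟨hs.1.1, by omega⟩
  choose g hgQ hg0 hg1 using hcol
  set J : Finset (P × R) := Finset.univ.filter fun p => p.2 ∈ Y p.1 ∧ t < congestion S p.2 with hJ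
  have hmem : ∀ p, p ∈ J ↔ p.2 ∈ Y p.1 ∧ t < congestion S p.2 := by simp [hJ]
  have hcap : ∑ p ∈ J, 3 * w p.2 ≤ 3 * c * ∑ r with t < congestion S r, w r := by
    have h1 : ∑ p ∈ J, 3 * w p.2 = ∑ r with t < congestion S r, congestion Y r * (3 * w r) := by
      rw [← sum_sum_inter, hJ, Finset.sum_filter, Fintype.sum_prod_type]
      refine Finset.sum_congr rfl fun i _ => ?_
      rw [← Finset.sum_filter]
      refine Finset.sum_congr ?_ fun _ _ => rfl
      ext; simp
    rw [h1, Finset.mul_sum]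
    refine Finset.sum_le_sum fun r _ => ?_
    calc congestion Y r * (3 * w r) ≤ c * (3 * w r) := Nat.mul_le_mul_right _ (hY r)
      _ = 3 * c * w r := by ring
  -- Each high `r ∈ Y i` is replaced, on either side, by low resources of weight at least `2 * w r`,
  -- which covers its colour class. Each side has two fifths of the low weight and the high weight
  -- is at most one fifth, so 3c uses suffice.
  have hpack : ∀ b : Bool, ∃ T : P × R → Finset R,
      (∀ p ∈ J, T p ⊆ L.filter (fun s => side s = b) ∧ 2 * w p.2 ≤ ∑ s ∈ T p, w s) ∧
      ∀ s ∈ L.filter (fun s => side s = b), (J.filter fun p => s ∈ T p).card ≤ 3 * c := by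
    intro b
    refine exists_packing _ w ((t + 1) ^ M) (fun s hs => hμ s (Finset.mem_filter.1 hs).1) J
      (fun p => 2 * w p.2) (fun p => 3 * w p.2) (fun p hp => ?_) (fun p hp => Or.inr ?_) _
      (hcap.trans_lt (Nat.mul_lt_mul_of_pos_left ?_ (by omega)))
    · have := hside b
      have := hwW p.2 ((hmem p).1 hp).2
      omega
    · have := hμw p.2 ((hmem p).1 hp).2
      omega
    · have := hside b
      have := hwW r₀ hr₀
      have := hμw r₀ hr₀
      omega
  choose T hT hTu using hpack
  -- A colour class is cut along the two sides, and each piece gets its alternative on the opposite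
  -- side. Base and alternative are then disjoint, so no weight is lost in the set differences.
  set base : P ⊕ (P × R × Bool) → Finset R := Sum.elim
    (fun i => (S i ∩ L).filter fun s => s ∈ Y i ∨ g i s = none)
    (fun k => ((S k.1 \ Y k.1) ∩ L).filter fun s => g k.1 s = some k.2.1 ∧ side s = !k.2.2)
    with hbase
  set alt : P ⊕ (P × R × Bool) → Finset R := Sum.elim (fun i => Y i ∩ L)
    (fun k => if (k.1, k.2.1) ∈ J then T k.2.2 (k.1, k.2.1) else ∅) with halt
  have hTL : ∀ k : P × R × Bool, ∀ s ∈ alt (Sum.inr k),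
      (k.1, k.2.1) ∈ J ∧ s ∈ T k.2.2 (k.1, k.2.1) ∧ s ∈ L ∧ side s = k.2.2 := by
    intro k s hs
    simp only [halt, Sum.elim_inr] at hs
    split_ifs at hs with h
    · have := Finset.mem_filter.1 ((hT _ _ h).1 hs)
      exact ⟨h, hs, this⟩
    · simp at hs
  have memL : ∀ s, s ∈ L ↔ congestion S s ≤ t := by simp [hL]
  refine ⟨base, alt, Sum.elim id Prod.fst, ?_, ?_, ?_, ?_, ?_⟩
  · rintro (i | k) s hs
    · have := (Finset.mem_inter.1 (Finset.mem_filter.1 hs).1)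
      exact ⟨this.1, (memL s).1 this.2⟩
    · have := (Finset.mem_inter.1 (Finset.mem_filter.1 hs).1)
      exact ⟨(Finset.mem_sdiff.1 this.1).1, (memL s).1 this.2⟩
  · intro i s hs hst
    have hsL := (memL s).2 hst
    by_cases h : s ∈ Y i ∨ g i s = none
    · refine ⟨Sum.inl i, ⟨rfl, by simp [hbase, hs, hsL, h]⟩, ?_⟩
      rintro (j | ⟨j, r, b⟩) ⟨rfl, hk⟩
      · rfl
      · simp only [hbase, Sum.elim_inr, Finset.mem_filter, Finset.mem_inter,
          Finset.mem_sdiff] at hk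
        rcases h with h | h
        · exact absurd h hk.1.1.2
        · exact absurd (h.symm.trans hk.2.1) (by simp)
    · push Not at h
      obtain ⟨r, hr⟩ := Option.ne_none_iff_exists'.1 h.2
      refine ⟨Sum.inr (i, r, !side s), ⟨rfl, by simp [hbase, hs, hsL, h.1, hr]⟩, ?_⟩
      rintro (j | ⟨j, r', b⟩) ⟨rfl, hk⟩
      · simp only [hbase, Sum.elim_inl, Finset.mem_filter] at hk
        rcases hk.2 with h' | h'
        · exact absurd h' h.1
        · exact absurd h' h.2
      · simp only [hbase, Sum.elim_inr, Finset.mem_filter] at hk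
        have h1 : r' = r := Option.some_injective _ (hk.2.1.symm.trans hr)
        rw [h1, hk.2.2, Bool.not_not]
        rfl
  · rintro (i | k) s hs
    · exact (memL s).1 (Finset.mem_inter.1 hs).2
    · exact (memL s).1 (hTL k s hs).2.2.1
  · rintro (i | ⟨i, r, b⟩)
    · refine le_trans (Finset.sum_le_sum_of_subset fun s hs => ?_) ((hg0 i).trans
        (Finset.sum_le_sum_of_subset fun s hs => ?_))
      · simp only [hbase, halt, Sum.elim_inl, Finset.mem_sdiff, Finset.mem_filter,
          Finset.mem_inter] at hs ⊢
        tauto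
      · simp only [hbase, halt, Sum.elim_inl, Finset.mem_sdiff, Finset.mem_filter,
          Finset.mem_inter] at hs ⊢
        tauto
    · have hd : Disjoint (base (Sum.inr (i, r, b))) (alt (Sum.inr (i, r, b))) := by
        refine Finset.disjoint_left.2 fun s hs hs' => ?_
        have h1 := (Finset.mem_filter.1 hs).2.2
        rw [(hTL _ s hs').2.2.2] at h1
        simp at h1
      rw [Finset.sdiff_eq_self_of_disjoint hd, Finset.sdiff_eq_self_of_disjoint hd.symm]
      by_cases h : (i, r) ∈ J
      · refine le_trans (Finset.sum_le_sum_of_subset fun s hs => ?_)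
          ((hg1 i r (by simpa using (hmem _).1 h)).trans ?_)
        · simp only [hbase, Sum.elim_inr, Finset.mem_filter] at hs ⊢
          exact ⟨hs.1, hs.2.1⟩
        · simp only [halt, Sum.elim_inr, h, if_true]
          exact (hT b _ h).2
      · rw [Finset.sum_eq_zero]
        · exact Nat.zero_le _
        · intro s hs
          simp only [hbase, Sum.elim_inr, Finset.mem_filter] at hs
          exact absurd ((hmem _).2 (by simpa using hgQ i s hs.1 r hs.2.1)) h
  · intro s
    rw [congestion_sum]
    have h1 : congestion (fun i => alt (Sum.inl i)) s ≤ c := by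
      refine le_trans (Finset.card_le_card fun i hi => ?_) (hY s)
      simp only [halt, Sum.elim_inl, Finset.mem_filter, Finset.mem_inter, Finset.mem_univ,
        true_and] at hi ⊢
      exact hi.1
    have h2 : congestion (fun k => alt (Sum.inr k)) s ≤ 3 * c := by
      by_cases hs : s ∈ L
      -- Only parts whose index `b` is the side of `s` have alternatives using `s`, so the bound 3c
      -- is not doubled.
      · refine le_trans ?_ (hTu (side s) s (by simp [hs]))
        refine Finset.card_le_card_of_injOn (fun k => (k.1, k.2.1)) (fun k hk => ?_)
          fun k hk k' hk' he => ?_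
        · have := hTL k s (by simpa using hk)
          simp [this]
        · have h3 := hTL k s (by simpa using hk)
          have h4 := hTL k' s (by simpa using hk')
          simp only [Prod.mk.injEq] at he
          exact Prod.ext he.1 (Prod.ext he.2 (h3.2.2.2.symm.trans h4.2.2.2))
      · rw [congestion, Finset.card_eq_zero.2]
        · exact Nat.zero_le _
        · refine Finset.filter_eq_empty_iff.2 fun k _ hk => hs (hTL k s hk).2.2.1
    omega

/-- As t ≤ 5c, the low parts can stay where they are, without choice. Above 5c the growth factor of
the power is at most e^(8/5) < 5. For t < n ≤ 5c the threshold is ψ, so n > 2M bounds the factor by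
e^(1/2) < 3, and n > 3c. -/
theorem exists_isTransform_of_small_degree [Nonempty R] {M : ℕ} (hM : 1 ≤ M)
    {G : CongestionGame P R} (hG : G.IsPolynomial M) {S : P → Finset R} (hS : G.IsNash S)
    (hc : 1 ≤ G.optCongestion) (hcS : 7 * G.optCongestion < bottleneck S)
    (hle : M ≤ 8 * G.optCongestion) :
    ∃ (G' : CongestionGame ((P × R) ⊕ P) R) (S' : (P × R) ⊕ P → Finset R)
      (origin : (P × R) ⊕ P → P), IsTransform M G S G' S' origin := by
  set c := G.optCongestion with hcdef
  set t := min (max (2 * M) (3 * c)) (5 * c) with ht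
  have h5 : ∀ n, 5 * c < n → (n + 1) ^ M ≤ 5 * n ^ M := fun n hn =>
    succ_pow_le_mul_pow 8 5 (by omega) (by norm_num) (by omega) (by norm_num)
  refine exists_isTransform_of_low hM hG hS t hc hcS (by omega) (min_le_left _ _) (fun n hn => ?_)
    (fun n _ hn => (h5 n (by omega)).trans (Nat.mul_le_mul_right _ (by norm_num)))
    (fun i => (S i).filter fun r => congestion S r ≤ t)
    (fun i => (S i).filter fun r => congestion S r ≤ t) id ?_ ?_ ?_ ?_ ?_ ?_
  · rcases le_or_gt n (5 * c) with h | h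
    · have h3 : (n + 1) ^ M ≤ 3 * n ^ M :=
        succ_pow_le_mul_pow 1 2 (by omega) (by norm_num) (by omega) (by norm_num)
      calc c * (n + 1) ^ M ≤ c * (3 * n ^ M) := Nat.mul_le_mul_left _ h3
        _ = 3 * c * n ^ M := by ring
        _ ≤ n * n ^ M := Nat.mul_le_mul_right _ (by omega)
    · calc c * (n + 1) ^ M ≤ c * (5 * n ^ M) := Nat.mul_le_mul_left _ (h5 n h)
        _ = 5 * c * n ^ M := by ring
        _ ≤ n * n ^ M := Nat.mul_le_mul_right _ h.le
  · intro k s hs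
    exact Finset.mem_filter.1 hs
  · intro i s hs hst
    exact ⟨i, ⟨rfl, by simp [hs, hst]⟩, fun j hj => hj.1⟩
  · intro k s hs
    exact (Finset.mem_filter.1 hs).2
  · simp
  · intro s
    rcases le_or_gt (congestion S s) t with h | h
    · refine le_trans (Finset.card_le_card fun i hi => ?_) (h.trans (min_le_right _ _))
      simp only [Finset.mem_filter, Finset.mem_univ, true_and] at hi ⊢
      exact hi.1
    · rw [congestion, Finset.card_eq_zero.2]
      · exact Nat.zero_le _
      · exact Finset.filter_eq_empty_iff.2 fun k _ hk =>
          absurd (Finset.mem_filter.1 hk).2 (by omega)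
  · intro s hs
    refine le_trans (Finset.card_le_card fun i hi => ?_) (congestion_le_bottleneck S s)
    simp only [Finset.mem_filter, Finset.mem_univ, true_and, or_self] at hi ⊢
    exact hi.1

/-- The threshold t = 2M - 4c leaves room for 4c alternatives on top of the base strategies of the
low parts: together at most 2M < C(S). From c < M/8 follow t > 3M/2, so the growth factor above t is
at most e^(2/3) < 2, and t > 12c. -/
theorem exists_isTransform_of_large_degree [Nonempty R] {M : ℕ}
    {G : CongestionGame P R} (hG : G.IsPolynomial M) {S : P → Finset R} (hS : G.IsNash S)
    (hc : 1 ≤ G.optCongestion) (hMS : 2 * M < bottleneck S) (hlt : 8 * G.optCongestion < M) :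
    ∃ (G' : CongestionGame ((P × R) ⊕ (P ⊕ (P × R × Bool))) R)
      (S' : (P × R) ⊕ (P ⊕ (P × R × Bool)) → Finset R)
      (origin : (P × R) ⊕ (P ⊕ (P × R × Bool)) → P), IsTransform M G S G' S' origin := by
  set c := G.optCongestion with hcdef
  set t := 2 * M - 4 * c with ht
  obtain ⟨Y, hY, hYc⟩ := G.exists_bottleneck_eq_optCongestion
  rw [← hcdef] at hYc
  obtain ⟨r₀, hr₀⟩ := exists_congestion_eq_bottleneck S
  have hYle : ∀ r, congestion Y r ≤ c := fun r => hYc ▸ congestion_le_bottleneck Y r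
  have h2 : ∀ n, t < n → (n + 1) ^ M ≤ 2 * n ^ M := fun n hn =>
    succ_pow_le_mul_pow 2 3 (by omega) (by norm_num) (by omega) (by norm_num)
  have h6 : ∀ n, t < n → 6 * c * (n + 1) ^ M ≤ n * n ^ M := fun n hn =>
    calc 6 * c * (n + 1) ^ M ≤ 6 * c * (2 * n ^ M) := Nat.mul_le_mul_left _ (h2 n hn)
      _ = 12 * c * n ^ M := by ring
      _ ≤ n * n ^ M := Nat.mul_le_mul_right _ (by omega)
  -- Above t, C_r^(M+1) ≥ 6c (C_r + 1)^M. The optimal state accounts for at most c of the six, and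
  -- the other five must be covered by c times the low weight.
  have hW : 5 * ∑ r with t < congestion S r, (congestion S r + 1) ^ M ≤
      ∑ r with congestion S r ≤ t, (congestion S r + 1) ^ M := by
    have h := hS.sum_congestion_mul_pow_le hG hY (Finset.univ.filter fun r => t < congestion S r)
    have hcompl : (Finset.univ.filter fun r => t < congestion S r)ᶜ =
        Finset.univ.filter fun r => congestion S r ≤ t := by
      ext; simp
    rw [hcompl, hYc] at h
    have h' : c * (5 * ∑ r with t < congestion S r, (congestion S r + 1) ^ M) +
        ∑ r with t < congestion S r, congestion Y r * (congestion S r + 1) ^ M ≤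
        ∑ r with t < congestion S r, congestion S r * congestion S r ^ M := by
      rw [← mul_assoc, Finset.mul_sum, ← Finset.sum_add_distrib]
      refine Finset.sum_le_sum fun r hr => ?_
      refine le_trans ?_ (h6 _ (Finset.mem_filter.1 hr).2)
      rw [← add_mul]
      exact Nat.mul_le_mul_right _ (by have := hYle r; omega)
    exact Nat.le_of_mul_le_mul_left (by omega) hc
  obtain ⟨base, alt, origin, hsub, hsplit, halt, hnash, huse⟩ :=
    exists_low_alternatives hc hYle (fun i => hS.sum_sdiff_le hG i (hY i)) ⟨r₀, by omega⟩ hW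
  refine exists_isTransform_of_low (by omega) hG hS t hc (by omega) (by omega) (by omega)
    (fun n hn => le_trans (Nat.mul_le_mul_right _ (by omega)) (h6 n hn))
    (fun n hn _ => (h2 n hn).trans (Nat.mul_le_mul_right _ (by norm_num)))
    base alt origin hsub hsplit halt hnash (fun s => (huse s).trans (by omega)) fun s hs => ?_
  have h7 : congestion base s ≤ congestion S s := by
    refine Finset.card_le_card_of_injOn origin (fun k hk => ?_) fun k hk k' hk' he => ?_
    · simpa using (hsub k s (by simpa using hk)).1
    · have h8 : s ∈ base k := by simpa using hk
      have h9 : s ∈ base k' := by simpa using hk'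
      exact (hsplit _ s (hsub k' s h9).1 hs).unique ⟨he, h8⟩ ⟨rfl, h9⟩
  have h8 := huse s
  rw [Finset.filter_or]
  refine (Finset.card_union_le _ _).trans ?_
  change congestion base s + congestion alt s ≤ _
  omega

theorem isTransform_self {M : ℕ} {G : CongestionGame P R} (hG : G.IsPolynomial M)
    {S : P → Finset R} (hS : G.IsHighestNash S)
    (hle : bottleneck S ≤ max (2 * M) (3 * G.optCongestion)) : IsTransform M G S G S id where
  isSplitting := ⟨fun _ => subset_rfl, fun i _ hr => ⟨i, ⟨rfl, hr⟩, fun _ hj => hj.1⟩⟩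
  isPolynomial := hG
  isHighestNash := hS
  onlyTypeAAbove r hr := absurd (congestion_le_bottleneck S r) (by omega)
  le_opt := le_rfl
  opt_le := by omega

/-- With equal base and alternative there is only one state, so the optimal congestion becomes C(S),
which is between c and 7c. -/
theorem exists_isTransform_of_bottleneck_le [Nonempty R] {M : ℕ} (hM : 1 ≤ M)
    {G : CongestionGame P R} {S : P → Finset R} (hS : G.IsState S)
    (hle : bottleneck S ≤ 7 * G.optCongestion) :
    ∃ (G' : CongestionGame (P × R) R) (S' : P × R → Finset R) (origin : P × R → P),
      IsTransform M G S G' S' origin := by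
  set b : P × R → Finset R := fun p => if p.2 ∈ S p.1 then {p.2} else ∅ with hb
  have hmem : ∀ p r, r ∈ b p ↔ p.2 = r ∧ r ∈ S p.1 := by
    intro p r
    by_cases h : p.2 ∈ S p.1
    · simp only [hb, h, if_true, Finset.mem_singleton]
      exact ⟨fun h' => ⟨h'.symm, h' ▸ h⟩, fun h' => h'.1.symm⟩
    · simp only [hb, h, if_false, Finset.notMem_empty, false_iff]
      rintro ⟨rfl, h'⟩; exact h h'
  have hsp : IsSplitting S b Prod.fst :=
    ⟨fun p r hr => ((hmem p r).1 hr).2, fun i r hr => ⟨(i, r), ⟨rfl, (hmem _ _).2 ⟨rfl, hr⟩⟩,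
      fun p hp => Prod.ext hp.1 ((hmem _ _).1 hp.2).1⟩⟩
  obtain ⟨r₀, hr₀⟩ := exists_congestion_eq_bottleneck S
  refine ⟨twoStrategyGame b b M, b, Prod.fst, isTransform_twoStrategyGame hM (fun _ => False) hsp
    ?_ (by simp) (by simp) ?_ ?_ ⟨r₀, Finset.univ.filter fun p => r₀ ∈ b p, by simp, ?_⟩⟩
  · intro p r hr _
    obtain ⟨rfl, h⟩ := (hmem p r).1 hr
    simp [hb, h]
  · intro r U hU
    refine le_trans (Finset.card_le_card fun k hk => ?_)
      ((hsp.congestion_eq r).le.trans (congestion_le_bottleneck S r))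
    simpa using hU k hk
  · intro r
    rw [hsp.congestion_eq]
    exact (congestion_le_bottleneck S r).trans hle
  · change _ ≤ congestion b r₀
    rw [hsp.congestion_eq, hr₀]
    exact hS.optCongestion_le

/-- If the optimum is 0, every player has the empty strategy available at cost 0, so an equilibrium
uses no resource. -/
theorem optCongestion_pos [Nonempty R] {M : ℕ} {G : CongestionGame P R} (hG : G.IsPolynomial M)
    {S : P → Finset R} (hS : G.IsNash S) (hpos : 0 < bottleneck S) : 1 ≤ G.optCongestion := by
  by_contra! h0
  obtain ⟨Y, hY, hYc⟩ := G.exists_bottleneck_eq_optCongestion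
  obtain ⟨r₀, hr₀⟩ := exists_congestion_eq_bottleneck S
  have h1 := hS.sum_congestion_mul_pow_le hG hY Finset.univ
  have h2 : ∀ r, congestion Y r = 0 := fun r => by
    have := congestion_le_bottleneck Y r
    omega
  have h3 : bottleneck Y = 0 := by omega
  simp only [h2, h3, zero_mul, Finset.sum_const_zero, add_zero, Nat.le_zero,
    Finset.sum_eq_zero_iff, Finset.mem_univ, true_implies] at h1
  have h4 := h1 r₀
  rw [hr₀] at h4
  exact absurd h4 (by positivity)

end Threshold

end CongestionGame

/-! ### Assembly of the four cases -/

theorem theorem3p2 {P R : Type*} [Fintype P] [DecidableEq P] [Nonempty P]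
    [Fintype R] [DecidableEq R] [Nonempty R] (M : ℕ) (hM : 1 ≤ M)
    (G : CongestionGame P R) (hG : G.IsPolynomial M)
    (S : P → Finset R) (hS : G.IsHighestNash S) :
    ∃ (n : ℕ) (G' : CongestionGame (Fin n) R) (S' : Fin n → Finset R) (origin : Fin n → P),
      0 < n ∧
      CongestionGame.IsSplitting S S' origin ∧
      G'.IsPolynomial M ∧
      G'.IsHighestNash S' ∧
      (∀ r, CongestionGame.congestion S' r = CongestionGame.congestion S r) ∧
      CongestionGame.OnlyTypeAAbove S' (max (2 * M) (3 * G.optCongestion)) ∧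
      CongestionGame.Dominates 7 G G' ∧
      G.priceOfAnarchy ≤ 7 * G'.priceOfAnarchy := by
  rcases le_or_gt (CongestionGame.bottleneck S) (max (2 * M) (3 * G.optCongestion)) with h1 | h1
  · exact (CongestionGame.isTransform_self hG hS h1).exists_fin hG hS
  rcases le_or_gt (CongestionGame.bottleneck S) (7 * G.optCongestion) with h2 | h2
  · obtain ⟨_, _, _, h⟩ := CongestionGame.exists_isTransform_of_bottleneck_le hM hS.1.1 h2
    exact h.exists_fin hG hS
  have hc := CongestionGame.optCongestion_pos hG hS.1 (by omega)
  rcases le_or_gt M (8 * G.optCongestion) with h3 | h3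
  · obtain ⟨_, _, _, h⟩ :=
      CongestionGame.exists_isTransform_of_small_degree hM hG hS.1 hc h2 h3
    exact h.exists_fin hG hS
  · obtain ⟨_, _, _, h⟩ :=
      CongestionGame.exists_isTransform_of_large_degree hG hS.1 hc (by omega) h3
    exact h.exists_fin hG hS
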